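/- Let $\mathcal X$ and $\mathcal Y$ be arbitrary sets and let $\mathcal H\subseteq\mathcal Y^{\mathcal X}$ be a nonempty hypothesis class. The Littlestone dimension $\mathrm L(\mathcal H)\in\mathbb N\cup\{\infty\}$ is the supremum of all $d$ for which there is a complete binary tree of depth $d$, with internal nodes labeled by elements of $\mathcal X$ and the two edges leaving each internal node labeled by two different elements of $\mathcal Y$, such that for every root-to-leaf path some $h\in\mathcal H$ maps the label of each internal node on the path to the label of the edge by which the path leaves it. The Bandit Littlestone dimension $\mathrm{BL}(\mathcal H)\in\mathbb N\cup\{\infty\}$ is the supremum of all $d$ for which there is a complete tree of depth $d$, with internal nodes labeled by elements of $\mathcal X$ and one edge for each $y\in\mathcal Y$ leaving each internal node, such that for every path $(y_1,\dots,y_d)\in\mathcal Y^d$, passing through nodes labeled $x_1,\dots,x_d$, some $h\in\mathcal H$ satisfies $h(x_t)\neq y_t$ for all $t\le d$. A bandit online learner plays against a sequence $(x_1,y_1),(x_2,y_2),\dots$ in $\mathcal X\times\mathcal Y$ that is fixed before the game. In round $t$ it sees $x_t$, makes a randomized prediction $\hat y_t\in\mathcal Y$ depending only on $x_t$ and on the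 instances, its own predictions and the losses of the earlier rounds, and is then told only the loss $\mathbf 1\{\hat y_t\neq y_t\}$. There exists a bandit online learner such that for every $T\ge 2$ and every sequence of labeled instances its expected regret satisfies $$\mathbb E\Big[\sum_{t=1}^T\mathbf 1\{\hat y_t\neq y_t\}\Big]-\inf_{h\in\mathcal H}\sum_{t=1}^T\mathbf 1\{h(x_t)\neq y_t\}\;\le\;8\sqrt{\mathrm L(\mathcal H)\,\mathrm{BL}(\mathcal H)\,T\ln T}.$$ (The right-hand side is $\infty$ if $\mathrm L(\mathcal H)$ or $\mathrm{BL}(\mathcal H)$ is infinite.) -/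

import Mathlib

open scoped ENNReal

namespace BanditOnline

universe u v

variable {X : Type u} {Y : Type v}

/-! ### Littlestone dimension and Bandit Littlestone dimension

A complete `X`-valued tree with edges out of every node indexed by `M` is given by its labelling
function `List M → X`: the list of the edges followed from the root (first edge first) names a node.
For a tree of depth `d` only the labels of nodes at distance less than `d` from the root matter. -/

/-- The binary tree of depth `d` with node labels `node` and edge labels `edge` (the edge leaving
node `p` in direction `b` carries the label `edge p b`) is shattered by `H`: every root-to-leaf path
is realized by a hypothesis of `H`. -/
def LShatters (H : Set (X → Y)) (d : ℕ) (node : List Bool → X) (edge : List Bool → Bool → Y) :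
    Prop :=
  (∀ p : List Bool, edge p true ≠ edge p false) ∧
  ∀ σ : List Bool, σ.length = d →
    ∃ h ∈ H, ∀ (t : ℕ) (ht : t < σ.length), h (node (σ.take t)) = edge (σ.take t) σ[t]

/-- The (multiclass) Littlestone dimension of `H`: the maximal depth of a shattered binary tree,
`⊤` if there are shattered trees of arbitrarily large depth. -/
noncomputable def Ldim (H : Set (X → Y)) : ℕ∞ :=
  ⨆ (d : ℕ) (_ : ∃ node edge, LShatters H d node edge), (d : ℕ∞)

/-- The `Y`-ary tree of depth `d` with node labels `node` is shattered by `H` in the bandit sense: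
for every root-to-leaf path some hypothesis of `H` disagrees with the path at each of its nodes. -/
def BLShatters (H : Set (X → Y)) (d : ℕ) (node : List Y → X) : Prop :=
  ∀ p : List Y, p.length = d →
    ∃ h ∈ H, ∀ (t : ℕ) (ht : t < p.length), h (node (p.take t)) ≠ p[t]

/-- The Bandit Littlestone dimension of `H`: the maximal depth of a `Y`-ary tree shattered in the
bandit sense, `⊤` if there are such trees of arbitrarily large depth. -/
noncomputable def BLdim (H : Set (X → Y)) : ℕ∞ :=
  ⨆ (d : ℕ) (_ : ∃ node, BLShatters H d node), (d : ℕ∞)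

/-! ### Online learning with bandit feedback -/

/-- What the learner has seen of one finished round: the instance, its own prediction, and the
loss bit, which is `true` if and only if the prediction was wrong. -/
structure Round (X : Type u) (Y : Type v) where
  inst : X
  pred : Y
  loss : Bool

/-- A randomized online learner under bandit feedback: from the finished rounds (most recent
first) and the current instance it computes the distribution of its next prediction. It is not told
the number of rounds. -/
def Learner (X : Type u) (Y : Type v) : Type (max u v) :=
  List (Round X Y) → X → PMF Y

open Classical in
/-- The law of the first `T` rounds (most recent first) when the learner `A` plays against
the fixed stream `z` of labeled instances. -/
noncomputable def transcript (A : Learner X Y) (z : ℕ → X × Y) : ℕ → PMF (List (Round X Y))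
  | 0 => PMF.pure []
  | t + 1 => (transcript A z t).bind fun past =>
      (A past (z t).1).map fun yhat =>
        { inst := (z t).1, pred := yhat, loss := decide (yhat ≠ (z t).2) } :: past

/-- The expected number of wrong predictions of `A` in the first `T` rounds on the stream `z`. -/
noncomputable def expectedLoss (A : Learner X Y) (z : ℕ → X × Y) (T : ℕ) : ℝ≥0∞ :=
  ∑' ω : List (Round X Y), transcript A z T ω * (ω.countP Round.loss : ℝ≥0∞)

open Classical in
/-- The number of mistakes of the fixed predictor `h` in the first `T` rounds of the stream `z`. -/
noncomputable def hypLoss (h : X → Y) (z : ℕ → X × Y) (T : ℕ) : ℕ :=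
  ((Finset.range T).filter fun t => h (z t).1 ≠ (z t).2).card

/-- The expected regret of `A` relative to `H` in the first `T` rounds on the stream `z`; the
comparator term is not random, and `expectedLoss A z T` is at most `T`. -/
noncomputable def expectedRegret (A : Learner X Y) (H : Set (X → Y)) (z : ℕ → X × Y) (T : ℕ) : ℝ :=
  (expectedLoss A z T).toReal - ⨅ h : H, (hypLoss h.1 z T : ℝ)

/-- The bound `8 √(L(H) · BL(H) · T · ln T)`, which is infinite if the product is. -/
noncomputable def regretBound (H : Set (X → Y)) (T : ℕ) : ℝ≥0∞ :=
  8 * (((Ldim H : ℕ∞) : ℝ≥0∞) * ((BLdim H : ℕ∞) : ℝ≥0∞) * (T : ℝ≥0∞)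
    * ENNReal.ofReal (Real.log T)) ^ (1 / 2 : ℝ)

end BanditOnline

/-!
If `BLdim H = b` is finite, then `H` takes at most `b + 1` labels at each instance
(`encard_labels_le`), because otherwise the tree whose nodes all carry this instance is shattered in
the bandit sense. So, although the label set may be infinite, the problem is one with `b + 1` arms,
and the classical route to agnostic online learning applies.

If moreover `Ldim H = L`, then for every horizon `n` there are `(1 + n b) ^ L` experts such that each
hypothesis is simulated by one of them on each instance sequence of length `n`
(`exists_expert_cover`): an expert runs the standard optimal algorithm, and deviates from it, to one
of `b` other labels, in the at most `L` rounds where that algorithm errs on the hypothesis.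

Exponential weights over `N` experts that use at most `k` labels, fed with importance-weighted loss
estimates, has regret `ln N / η + η k n / 2` (`expectedLoss_expWeights_le`). The proof follows the
`potential`, `η` times the number of mistakes plus the logarithm of the total weight relative to the
weight of the best expert: it starts at `ln N`, dominates `η` times the number of mistakes, and in
each round its expectation grows by at most `η` times the loss of the best expert plus `η² k / 2`
(`sum_potential_le`). It is nonnegative, so that its expectation can be taken in `ℝ≥0∞`.

The number of rounds is unknown, hence the learner restarts with a new rate in epochs of lengths
`1, 2, 4, …` (`doubling`), whose regrets form a geometric sum. The constant `8` covers all losses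
(`sum_epoch_regret_le`) as soon as the bound is below the trivial bound `T`, which forces `b` to be
small compared with `T`. The degenerate cases are a vanishing dimension, where all hypotheses agree,
and an infinite one, where the bound is infinite.
-/

namespace BanditOnline

universe u v

variable {X : Type u} {Y : Type v}

/-! ### Combinatorics of the two dimensions -/

/-- Some binary tree of depth `d` is shattered by `H`. -/
def LShatterable (H : Set (X → Y)) (d : ℕ) : Prop :=
  ∃ node edge, LShatters H d node edge

theorem not_lShatterable_succ {H : Set (X → Y)} {d : ℕ} (hd : Ldim H = d) :
    ¬ LShatterable H (d + 1) := by
  intro h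
  have h1 : ((d + 1 : ℕ) : ℕ∞) ≤ Ldim H :=
    le_iSup₂ (f := fun (d : ℕ) (_ : ∃ node edge, LShatters H d node edge) => (d : ℕ∞)) (d + 1) h
  rw [hd] at h1
  have := Nat.cast_le.mp h1
  omega

theorem not_blShatters_succ {H : Set (X → Y)} {b : ℕ} (hb : BLdim H = b) (node : List Y → X) :
    ¬ BLShatters H (b + 1) node := by
  intro h
  have h1 : ((b + 1 : ℕ) : ℕ∞) ≤ BLdim H :=
    le_iSup₂ (f := fun (d : ℕ) (_ : ∃ node, BLShatters H d node) => (d : ℕ∞)) (b + 1) ⟨node, h⟩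
  rw [hb] at h1
  have := Nat.cast_le.mp h1
  omega

/-- The labels that `H` takes at one instance are at most `BLdim H + 1` many: otherwise the tree
all of whose nodes carry this instance is shattered in the bandit sense. -/
theorem encard_labels_le {H : Set (X → Y)} {b : ℕ} (hb : BLdim H = b) (x : X) :
    ((fun h : X → Y => h x) '' H).encard ≤ b + 1 := by
  classical
  by_contra hcon
  refine not_blShatters_succ hb (fun _ => x) fun p hp => ?_
  by_contra hno
  push Not at hno
  refine hcon ?_
  have hsub : ((fun h : X → Y => h x) '' H) ⊆ (p.toFinset : Set Y) := by
    rintro _ ⟨h, hh, rfl⟩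
    obtain ⟨t, ht, he⟩ := hno h hh
    simp only [List.coe_toFinset, Set.mem_ofPred_eq]
    rw [he]
    exact List.getElem_mem ht
  calc _ ≤ (p.toFinset : Set Y).encard := Set.encard_le_encard hsub
    _ = (p.toFinset.card : ℕ∞) := Set.encard_coe_eq_coe_finsetCard _
    _ ≤ ((b + 1 : ℕ) : ℕ∞) := by
        rw [← hp]
        exact_mod_cast p.toFinset_card_le
    _ = b + 1 := by norm_cast

/-- Two shattered trees for the hypotheses with label `y`, respectively `y'`, at `x` are glued below
a new root `x`. -/
theorem LShatterable.glue {V : Set (X → Y)} {x : X} {y y' : Y} (hne : y ≠ y') {d : ℕ}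
    (h₁ : LShatterable {h ∈ V | h x = y} d) (h₂ : LShatterable {h ∈ V | h x = y'} d) :
    LShatterable V (d + 1) := by
  obtain ⟨n₁, e₁, hd₁, hs₁⟩ := h₁
  obtain ⟨n₂, e₂, hd₂, hs₂⟩ := h₂
  refine ⟨fun p => p.casesOn x fun c q => bif c then n₁ q else n₂ q,
    fun p => p.casesOn (fun c => bif c then y else y') fun c q => bif c then e₁ q else e₂ q, ?_, ?_⟩
  · rintro (_ | ⟨_ | _, q⟩)
    · exact hne
    · exact hd₂ q
    · exact hd₁ q
  · rintro (_ | ⟨_ | _, q⟩) hσ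
    · simp at hσ
    · obtain ⟨h, hh, hp⟩ := hs₂ q (by simpa using hσ)
      refine ⟨h, hh.1, ?_⟩
      rintro (_ | t) ht
      · simpa using hh.2
      · simpa using hp t (by simpa using ht)
    · obtain ⟨h, hh, hp⟩ := hs₁ q (by simpa using hσ)
      refine ⟨h, hh.1, ?_⟩
      rintro (_ | t) ht
      · simpa using hh.2
      · simpa using hp t (by simpa using ht)

theorem eq_of_not_lShatterable_one {V : Set (X → Y)} (hV : ¬ LShatterable V 1) {h h' : X → Y}
    (hh : h ∈ V) (hh' : h' ∈ V) : h = h' := by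
  funext x
  by_contra hne
  have key : ∀ g ∈ V, LShatterable {k ∈ V | k x = g x} 0 := fun g hg =>
    ⟨fun _ => x, fun _ c => bif c then h x else h' x, fun _ => hne, fun σ hσ =>
      ⟨g, ⟨hg, rfl⟩, fun t ht => absurd ht (by omega)⟩⟩
  exact hV ((key h hh).glue hne (key h' hh'))

/-- The label that the standard optimal algorithm predicts: every other label makes the Littlestone
dimension of the version space drop. -/
theorem exists_optimal_label [Nonempty Y] {V : Set (X → Y)} {d : ℕ} (hV : ¬ LShatterable V (d + 1))
    (x : X) : ∃ y₀, ∀ y, y ≠ y₀ → ¬ LShatterable {h ∈ V | h x = y} d := by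
  by_cases hex : ∃ y₀, LShatterable {h ∈ V | h x = y₀} d
  · obtain ⟨y₀, h₀⟩ := hex
    exact ⟨y₀, fun y hy hs => hV (hs.glue hy h₀)⟩
  · push Not at hex
    exact ⟨Classical.arbitrary Y, fun y _ => hex y⟩

theorem LShatterable.mono {V W : Set (X → Y)} (hVW : V ⊆ W) {d : ℕ} (h : LShatterable V d) :
    LShatterable W d := by
  obtain ⟨n, e, h₁, h₂⟩ := h
  exact ⟨n, e, h₁, fun σ hσ => (h₂ σ hσ).imp fun _ hh => ⟨hVW hh.1, hh.2⟩⟩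

/-- Without one of its elements, a set of at most `b + 1` elements is enumerated by `Fin b`,
possibly with repetitions and with labels outside of the set. -/
theorem exists_enumeration_diff [Nonempty Y] {S : Set Y} {b : ℕ} (hS : S.encard ≤ b + 1) {y₀ : Y}
    (hy₀ : y₀ ∈ S) : ∃ g : Fin b → Y, S \ {y₀} ⊆ Set.range g := by
  have hcard : (S \ {y₀}).encard ≤ b := by
    have h := Set.encard_sdiff_singleton_add_one hy₀
    rw [← h] at hS
    exact (ENat.add_le_add_iff_right ENat.one_ne_top).mp hS
  have hfin : (S \ {y₀}).Finite := Set.finite_of_encard_le_coe hcard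
  have hle : hfin.toFinset.card ≤ b := by
    rw [hfin.encard_eq_coe_toFinset_card] at hcard
    exact_mod_cast hcard
  have e := hfin.toFinset.equivFin
  refine ⟨fun j => if hj : (j : ℕ) < hfin.toFinset.card then (e.symm ⟨j, hj⟩ : Y)
    else Classical.arbitrary Y, fun y hy => ?_⟩
  have hy' : y ∈ hfin.toFinset := hfin.mem_toFinset.mpr hy
  have hlt := (e ⟨y, hy'⟩).isLt
  exact ⟨⟨e ⟨y, hy'⟩, hlt.trans_le hle⟩, by simp [hlt]⟩

/-- Experts covering a class without shattered trees of depth `d + 1`, on instance sequences of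
length `n`. An expert predicts from the earlier instances (first one first) and the current one.
It follows the standard optimal algorithm, except in at most `d` rounds, where it follows another
of the `b` remaining labels; there are at most `(1 + n b) ^ d` such schedules. -/
theorem exists_expert_cover [Nonempty Y] (b : ℕ) : ∀ n d : ℕ, ∃ (ι : Type) (_ : Fintype ι),
    Nonempty ι ∧ Fintype.card ι ≤ (1 + n * b) ^ d ∧ ∀ V : Set (X → Y), ¬ LShatterable V (d + 1) →
      (∀ x, ((fun h : X → Y => h x) '' V).encard ≤ b + 1) →
      ∃ f : ι → List X → X → Y, ∀ h ∈ V, ∀ xs : List X, xs.length = n →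
        ∃ i, ∀ (t : ℕ) (ht : t < xs.length), f i (xs.take t) xs[t] = h xs[t] := by
  intro n
  induction n with
  | zero =>
    intro d
    refine ⟨Unit, inferInstance, inferInstance, by simp, fun V _ _ =>
      ⟨fun _ _ _ => Classical.arbitrary Y, fun h _ xs hxs => ⟨(), fun t ht => absurd ht (by omega)⟩⟩⟩
  | succ n ih =>
    intro d
    cases d with
    | zero =>
      refine ⟨Unit, inferInstance, inferInstance, by simp, fun V hV _ => ?_⟩
      by_cases hne : V.Nonempty
      · obtain ⟨h₀, hh₀⟩ := hne
        refine ⟨fun _ _ x => h₀ x, fun h hh xs _ => ⟨(), fun t ht => ?_⟩⟩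
        rw [eq_of_not_lShatterable_one hV hh hh₀]
      · exact ⟨fun _ _ _ => Classical.arbitrary Y, fun h hh => absurd ⟨h, hh⟩ hne⟩
    | succ d =>
      obtain ⟨ι₁, _, hne₁, hc₁, hf₁⟩ := ih (d + 1)
      obtain ⟨ι₂, _, hne₂, hc₂, hf₂⟩ := ih d
      refine ⟨ι₁ ⊕ (Fin b × ι₂), inferInstance, inferInstance, ?_, fun V hV hcard => ?_⟩
      · simp only [Fintype.card_sum, Fintype.card_prod, Fintype.card_fin]
        calc _ ≤ (1 + n * b) ^ (d + 1) + b * (1 + n * b) ^ d := by gcongr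
          _ = (1 + (n + 1) * b) * (1 + n * b) ^ d := by ring
          _ ≤ (1 + (n + 1) * b) * (1 + (n + 1) * b) ^ d := by gcongr; omega
          _ = _ := by ring
      · have hsub : ∀ x y, {h ∈ V | h x = y} ⊆ V := fun x y h hh => hh.1
        have hcard' : ∀ x y x', ((fun h : X → Y => h x') '' {h ∈ V | h x = y}).encard ≤ b + 1 :=
          fun x y x' => (Set.encard_le_encard (Set.image_mono (hsub x y))).trans (hcard x')
        -- The optimal label `y₀ x`, with an enumeration `g x` of the other labels in use at `x`.
        have hlab : ∀ x, ∃ (y₀ : Y) (g : Fin b → Y),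
            (∀ y, y ≠ y₀ → ¬ LShatterable {h ∈ V | h x = y} (d + 1)) ∧
            ∀ h ∈ V, h x ≠ y₀ → h x ∈ Set.range g := by
          intro x
          obtain ⟨y₀, hy₀⟩ := exists_optimal_label hV x
          by_cases hmem : y₀ ∈ (fun h : X → Y => h x) '' V
          · obtain ⟨g, hg⟩ := exists_enumeration_diff (hcard x) hmem
            exact ⟨y₀, g, hy₀, fun h hh hne => hg ⟨⟨h, hh, rfl⟩, hne⟩⟩
          · -- No hypothesis takes the label `y₀`, so that any label of `V` may take its place.
            by_cases hne : V.Nonempty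
            · obtain ⟨h₁, hh₁⟩ := hne
              obtain ⟨g, hg⟩ := exists_enumeration_diff (hcard x) ⟨h₁, hh₁, rfl⟩
              refine ⟨h₁ x, g, fun y hy => ?_, fun h hh hne => hg ⟨⟨h, hh, rfl⟩, hne⟩⟩
              by_cases hyy : y = y₀
              · rintro ⟨n, e, -, hs⟩
                obtain ⟨h, hh, -⟩ := hs (List.replicate (d + 1) true) (by simp)
                exact hmem ⟨h, hh.1, hh.2.trans hyy⟩
              · exact hy₀ y hyy
            · exact ⟨y₀, fun _ => y₀, hy₀, fun h hh => absurd ⟨h, hh⟩ hne⟩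
        choose y₀ g hy₀ hg using hlab
        have hF₁ := fun x => hf₁ {h ∈ V | h x = y₀ x} (fun hs => hV (hs.mono (hsub _ _)))
          (hcard' x (y₀ x))
        choose f₁ hf₁ using hF₁
        -- An index `j` with `g x j = y₀ x` is idle, so that its experts may be arbitrary.
        have hF₂ : ∀ x j, ∃ f : ι₂ → List X → X → Y, g x j ≠ y₀ x →
            ∀ h ∈ {h ∈ V | h x = g x j}, ∀ xs : List X, xs.length = n →
              ∃ i, ∀ (t : ℕ) (ht : t < xs.length), f i (xs.take t) xs[t] = h xs[t] := by
          intro x j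
          by_cases hj : g x j = y₀ x
          · exact ⟨fun _ _ _ => y₀ x, fun hj' => absurd hj hj'⟩
          · obtain ⟨f, hf⟩ := hf₂ {h ∈ V | h x = g x j} (hy₀ x _ hj) (hcard' x _)
            exact ⟨f, fun _ => hf⟩
        choose f₂ hf₂ using hF₂
        refine ⟨fun i l x => match i, l with
          | .inl _, [] => y₀ x
          | .inl i, x' :: l => f₁ x' i l x
          | .inr (j, _), [] => g x j
          | .inr (j, i), x' :: l => f₂ x' j i l x, fun h hh xs hxs => ?_⟩
        obtain _ | ⟨x, xs⟩ := xs
        · simp at hxs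
        · have hlen : xs.length = n := by simpa using hxs
          by_cases hx : h x = y₀ x
          · obtain ⟨i, hi⟩ := hf₁ x h ⟨hh, hx⟩ xs hlen
            refine ⟨.inl i, ?_⟩
            rintro (_ | t) ht
            · simpa using hx.symm
            · simpa using hi t (by simpa using ht)
          · obtain ⟨j, hj⟩ := hg x h hh hx
            obtain ⟨i, hi⟩ := hf₂ x j (by rwa [hj]) h ⟨hh, hj.symm⟩ xs hlen
            refine ⟨.inr (j, i), ?_⟩
            rintro (_ | t) ht
            · simpa using hj
            · simpa using hi t (by simpa using ht)

/-! ### Expectations and the transcript -/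

/-- The expectation of a nonnegative function under a discrete law. -/
noncomputable def expect {α : Type*} (p : PMF α) (φ : α → ℝ≥0∞) : ℝ≥0∞ := ∑' a, p a * φ a

section Expect

variable {α β : Type*}

theorem expect_pure (a : α) (φ : α → ℝ≥0∞) : expect (PMF.pure a) φ = φ a := by
  classical
  rw [expect, tsum_eq_single a]
  · simp
  · intro b hb
    simp [PMF.pure_apply, hb]

theorem expect_bind (p : PMF α) (k : α → PMF β) (φ : β → ℝ≥0∞) :
    expect (p.bind k) φ = expect p fun a => expect (k a) φ := by
  simp only [expect, PMF.bind_apply, ← ENNReal.tsum_mul_right, ← ENNReal.tsum_mul_left]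
  rw [ENNReal.tsum_comm]
  simp only [mul_assoc]

theorem expect_map (p : PMF α) (g : α → β) (φ : β → ℝ≥0∞) :
    expect (p.map g) φ = expect p fun a => φ (g a) := by
  rw [← PMF.bind_pure_comp, expect_bind]
  simp only [Function.comp, expect_pure]

theorem expect_mono (p : PMF α) {φ ψ : α → ℝ≥0∞} (h : ∀ a, φ a ≤ ψ a) :
    expect p φ ≤ expect p ψ :=
  ENNReal.tsum_le_tsum fun a => by gcongr; exact h a

theorem expect_congr_support (p : PMF α) {φ ψ : α → ℝ≥0∞} (h : ∀ a ∈ p.support, φ a = ψ a) :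
    expect p φ = expect p ψ :=
  tsum_congr fun a => by
    by_cases ha : p a = 0
    · simp [ha]
    · rw [h a ((p.mem_support_iff a).mpr ha)]

theorem expect_add (p : PMF α) (φ ψ : α → ℝ≥0∞) :
    expect p (fun a => φ a + ψ a) = expect p φ + expect p ψ := by
  simp only [expect, mul_add, ENNReal.tsum_add]

theorem expect_const (p : PMF α) (c : ℝ≥0∞) : expect p (fun _ => c) = c := by
  simp [expect, ENNReal.tsum_mul_right]

theorem expect_const_mul (p : PMF α) (c : ℝ≥0∞) (φ : α → ℝ≥0∞) :
    expect p (fun a => c * φ a) = c * expect p φ := by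
  simp only [expect, ← ENNReal.tsum_mul_left]
  exact tsum_congr fun a => by ring

end Expect

theorem expectedLoss_eq_expect (A : Learner X Y) (z : ℕ → X × Y) (T : ℕ) :
    expectedLoss A z T = expect (transcript A z T) fun ω => (ω.countP Round.loss : ℝ≥0∞) := rfl

open Classical in
/-- The round in which `yhat` is predicted for the labeled instance `a`. -/
noncomputable def playedRound (a : X × Y) (yhat : Y) : Round X Y :=
  { inst := a.1, pred := yhat, loss := decide (yhat ≠ a.2) }

theorem transcript_succ (A : Learner X Y) (z : ℕ → X × Y) (t : ℕ) :
    transcript A z (t + 1) = (transcript A z t).bind fun past =>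
      (A past (z t).1).map fun yhat => playedRound (z t) yhat :: past := rfl

theorem expect_transcript_succ (A : Learner X Y) (z : ℕ → X × Y) (t : ℕ)
    (φ : List (Round X Y) → ℝ≥0∞) :
    expect (transcript A z (t + 1)) φ = expect (transcript A z t) fun past =>
      expect (A past (z t).1) fun yhat => φ (playedRound (z t) yhat :: past) := by
  rw [transcript_succ, expect_bind]
  simp only [expect_map]

/-- Along every possible transcript the instances are those of the stream. -/
theorem map_inst_of_mem_support (A : Learner X Y) (z : ℕ → X × Y) :
    ∀ (t : ℕ), ∀ ω ∈ (transcript A z t).support,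
      (ω.map Round.inst).reverse = (List.range t).map fun s => (z s).1 := by
  intro t
  induction t with
  | zero =>
    intro ω hω
    have : ω = [] := by simpa [transcript] using hω
    simp [this]
  | succ t ih =>
    intro ω hω
    rw [transcript_succ, PMF.mem_support_bind_iff] at hω
    obtain ⟨past, hp, hω⟩ := hω
    obtain ⟨y, -, rfl⟩ := (PMF.mem_support_map_iff _ _ _).mp hω
    simp [List.range_succ, ih past hp, playedRound]

theorem length_of_mem_support (A : Learner X Y) (z : ℕ → X × Y) {t : ℕ} {ω : List (Round X Y)}
    (hω : ω ∈ (transcript A z t).support) : ω.length = t := by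
  simpa using congrArg List.length (map_inst_of_mem_support A z t ω hω)

theorem expectedLoss_le (A : Learner X Y) (z : ℕ → X × Y) (T : ℕ) : expectedLoss A z T ≤ T := by
  rw [expectedLoss_eq_expect]
  calc _ ≤ expect (transcript A z T) fun ω => (ω.length : ℝ≥0∞) :=
        expect_mono _ fun ω => by exact_mod_cast List.countP_le_length
    _ = expect (transcript A z T) fun _ => (T : ℝ≥0∞) :=
        expect_congr_support _ fun ω hω => by rw [length_of_mem_support A z hω]
    _ = T := expect_const _ _

theorem hypLoss_zero (h : X → Y) (z : ℕ → X × Y) : hypLoss h z 0 = 0 := by simp [hypLoss]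

open Classical in
theorem hypLoss_succ (h : X → Y) (z : ℕ → X × Y) (t : ℕ) :
    hypLoss h z (t + 1) = hypLoss h z t + if h (z t).1 ≠ (z t).2 then 1 else 0 := by
  unfold hypLoss
  rw [Finset.range_add_one, Finset.filter_insert]
  split_ifs with hc
  · rw [Finset.card_insert_of_notMem (by simp)]
  · rfl

theorem hypLoss_add (h : X → Y) (z : ℕ → X × Y) (s j : ℕ) :
    hypLoss h z (s + j) = hypLoss h z s + hypLoss h (fun t => z (s + t)) j := by
  induction j with
  | zero => simp [hypLoss_zero]
  | succ j ih => rw [← add_assoc, hypLoss_succ, hypLoss_succ, ih, add_assoc]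

/-- The learner that always predicts with `h`. -/
noncomputable def follow (h : X → Y) : Learner X Y := fun _ x => PMF.pure (h x)

theorem expectedLoss_follow (h : X → Y) (z : ℕ → X × Y) (T : ℕ) :
    expectedLoss (follow h) z T = hypLoss h z T := by
  classical
  rw [expectedLoss_eq_expect]
  induction T with
  | zero => simp [transcript, expect_pure, hypLoss_zero]
  | succ T ih =>
    rw [expect_transcript_succ, hypLoss_succ, Nat.cast_add, ← ih]
    simp only [follow, expect_pure, List.countP_cons, Nat.cast_add, expect_add]
    congr 1
    simp [expect_const, playedRound]

/-! ### Restarting a learner in epochs of doubling length -/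

/-- The learner that restarts in rounds `2 ^ m - 1` (`m = 0, 1, …`, rounds counted from `0`), and
plays `B m` from then on until the next restart, after `2 ^ m` rounds. -/
noncomputable def doubling (B : ℕ → Learner X Y) : Learner X Y := fun past x =>
  B (Nat.log 2 (past.length + 1))
    (past.take (past.length + 1 - 2 ^ Nat.log 2 (past.length + 1))) x

theorem transcript_doubling (B : ℕ → Learner X Y) (z : ℕ → X × Y) (m : ℕ) :
    ∀ j ≤ 2 ^ m, transcript (doubling B) z (2 ^ m - 1 + j) =
      (transcript (doubling B) z (2 ^ m - 1)).bind fun past =>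
        (transcript (B m) (fun t => z (2 ^ m - 1 + t)) j).map fun ω => ω ++ past := by
  intro j
  induction j with
  | zero => simp [transcript, PMF.pure_map, PMF.bind_pure]
  | succ j ih =>
    intro hj
    have hpos : 0 < 2 ^ m := by positivity
    rw [← add_assoc, transcript_succ, transcript_succ, ih (by omega)]
    simp only [PMF.bind_bind, PMF.map_bind, PMF.bind_map, PMF.map_comp, Function.comp_def,
      List.cons_append]
    ext ω'
    simp only [PMF.bind_apply]
    refine tsum_congr fun past => ?_
    by_cases hp : transcript (doubling B) z (2 ^ m - 1) past = 0
    · simp [hp]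
    congr 1
    refine tsum_congr fun ω => ?_
    by_cases hω : transcript (B m) (fun t => z (2 ^ m - 1 + t)) j ω = 0
    · simp [hω]
    have hlp := length_of_mem_support _ _ ((PMF.mem_support_iff _ _).mpr hp)
    have hlω := length_of_mem_support _ _ ((PMF.mem_support_iff _ _).mpr hω)
    have hlog : Nat.log 2 ((ω ++ past).length + 1) = m := by
      rw [List.length_append, hlp, hlω]
      exact Nat.log_eq_of_pow_le_of_lt_pow (by omega) (by rw [pow_succ]; omega)
    have htake : (ω ++ past).take ((ω ++ past).length + 1 - 2 ^ m) = ω := by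
      have : (ω ++ past).length + 1 - 2 ^ m = ω.length := by
        rw [List.length_append, hlp, hlω]; omega
      rw [this, List.take_left]
    simp only [doubling, hlog, htake]

theorem expectedLoss_doubling (B : ℕ → Learner X Y) (z : ℕ → X × Y) (m j : ℕ) (hj : j ≤ 2 ^ m) :
    expectedLoss (doubling B) z (2 ^ m - 1 + j) = expectedLoss (doubling B) z (2 ^ m - 1) +
      expectedLoss (B m) (fun t => z (2 ^ m - 1 + t)) j := by
  rw [expectedLoss_eq_expect, transcript_doubling B z m j hj, expect_bind]
  simp only [expect_map, List.countP_append, Nat.cast_add, expect_add, expect_const]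
  rw [add_comm]
  rfl

/-- The regrets of the epochs add up. -/
theorem expectedLoss_doubling_le (B : ℕ → Learner X Y) (R : ℕ → ℝ≥0∞) (h : X → Y)
    (hB : ∀ m, ∀ z : ℕ → X × Y, ∀ j ≤ 2 ^ m, expectedLoss (B m) z j ≤ hypLoss h z j + R m)
    (z : ℕ → X × Y) (m j : ℕ) (hj : j ≤ 2 ^ m) :
    expectedLoss (doubling B) z (2 ^ m - 1 + j) ≤
      hypLoss h z (2 ^ m - 1 + j) + ∑ i ∈ Finset.range (m + 1), R i := by
  induction m generalizing j with
  | zero =>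
    rw [expectedLoss_doubling B z 0 j hj]
    have := hB 0 (fun t => z (0 + t)) j hj
    simpa [expectedLoss_eq_expect, transcript, expect_pure] using this
  | succ m ih =>
    have hpos : 0 < 2 ^ m := by positivity
    have hs : 2 ^ (m + 1) - 1 = 2 ^ m - 1 + 2 ^ m := by rw [pow_succ]; omega
    rw [expectedLoss_doubling B z (m + 1) j hj, hypLoss_add, Finset.sum_range_succ, Nat.cast_add]
    have h₁ := ih (2 ^ m) le_rfl
    rw [← hs] at h₁
    refine (add_le_add h₁ (hB (m + 1) (fun t => z (2 ^ (m + 1) - 1 + t)) j hj)).trans_eq ?_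
    ring

/-! ### One round of exponential weights with importance-weighted losses -/

theorem exp_neg_le_quadratic {x : ℝ} (hx : 0 ≤ x) : Real.exp (-x) ≤ 1 - x + x ^ 2 / 2 := by
  have h := Real.quadratic_le_exp_of_nonneg hx
  rw [Real.exp_neg, inv_le_comm₀ (Real.exp_pos x) (by nlinarith [sq_nonneg (x - 1)])]
  refine le_trans ?_ h
  rw [inv_le_comm₀ (by nlinarith [sq_nonneg (x - 1)]) (by positivity),
    inv_le_iff_one_le_mul₀ (by positivity)]
  nlinarith [sq_nonneg (x ^ 2)]

section Weights

variable {ι : Type*} [Fintype ι]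

open Classical in
/-- The share of the weight `w` on the experts that predict `y`. -/
noncomputable def labelShare (w : ι → ℝ) (g : ι → Y) (y : Y) : ℝ :=
  (∑ i, if g i = y then w i else 0) / ∑ i, w i

open Classical in
/-- The importance-weighted estimate of the loss of expert `i`, which predicts `g i`, after the
prediction `y` was played and found wrong (`l = true`) or right. -/
noncomputable def lossEstimate (w : ι → ℝ) (g : ι → Y) (y : Y) (l : Bool) (i : ι) : ℝ :=
  if g i = y ∧ l = true then 1 / labelShare w g y else 0

theorem labelShare_pos [Nonempty ι] {w : ι → ℝ} (hw : ∀ i, 0 < w i) (g : ι → Y) (j : ι) :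
    0 < labelShare w g (g j) := by
  classical
  refine div_pos ?_ (Finset.sum_pos (fun i _ => hw i) Finset.univ_nonempty)
  refine (hw j).trans_le ?_
  have := Finset.single_le_sum (f := fun i => if g i = g j then w i else 0)
    (fun i _ => by split_ifs <;> [exact (hw i).le; exact le_rfl]) (Finset.mem_univ j)
  simpa using this

/-- After a round with prediction `g j` the logarithm of the total weight has dropped by `η` times
the loss, up to a second-order term. -/
theorem log_sum_exp_lossEstimate_le [Nonempty ι] {w : ι → ℝ} (hw : ∀ i, 0 < w i) (g : ι → Y)
    {η : ℝ} (hη : 0 ≤ η) (j : ι) (l : Bool) :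
    Real.log (∑ i, w i * Real.exp (-η * lossEstimate w g (g j) l i)) ≤
      Real.log (∑ i, w i) - (if l = true then η else 0) + η ^ 2 / (2 * labelShare w g (g j)) := by
  classical
  have hP := labelShare_pos hw g j
  set P := labelShare w g (g j) with hPdef
  have hW : 0 < ∑ i, w i := Finset.sum_pos (fun i _ => hw i) Finset.univ_nonempty
  cases l with
  | false =>
    have : 0 ≤ η ^ 2 / (2 * P) := by positivity
    simpa [lossEstimate] using this
  | true =>
    have hsum : (∑ i, w i * Real.exp (-η * lossEstimate w g (g j) true i)) =
        (∑ i, w i) * (1 + P * (Real.exp (-(η / P)) - 1)) := by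
      have h₁ : ∀ i, w i * Real.exp (-η * lossEstimate w g (g j) true i) =
          w i + (if g i = g j then w i else 0) * (Real.exp (-(η / P)) - 1) := by
        intro i
        by_cases hi : g i = g j
        · have : -η * (1 / P) = -(η / P) := by ring
          simp only [lossEstimate, hi, ← hPdef, and_self, if_true, this]
          ring
        · simp [lossEstimate, hi]
      have h₂ : (∑ i, if g i = g j then w i else 0) = (∑ i, w i) * P := by
        rw [hPdef, labelShare]
        field_simp
      rw [Finset.sum_congr rfl fun i _ => h₁ i, Finset.sum_add_distrib, ← Finset.sum_mul, h₂]
      ring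
    have hpos : 0 < ∑ i, w i * Real.exp (-η * lossEstimate w g (g j) true i) :=
      Finset.sum_pos (fun i _ => mul_pos (hw i) (Real.exp_pos _)) Finset.univ_nonempty
    rw [hsum] at hpos ⊢
    have hfac : 0 < 1 + P * (Real.exp (-(η / P)) - 1) := (mul_pos_iff_of_pos_left hW).mp hpos
    rw [Real.log_mul hW.ne' hfac.ne']
    have h₁ := Real.log_le_sub_one_of_pos hfac
    have h₂ := exp_neg_le_quadratic (x := η / P) (by positivity)
    have h₃ : P * (Real.exp (-(η / P)) - 1) ≤ P * (-(η / P) + (η / P) ^ 2 / 2) := by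
      gcongr; linarith
    have h₄ : P * (-(η / P) + (η / P) ^ 2 / 2) = -η + η ^ 2 / (2 * P) := by
      field_simp
    simp only [if_true]
    linarith

/-- The expected inverse probability of the played prediction is the number of predictions. -/
theorem sum_div_labelShare [Nonempty ι] [DecidableEq Y] {w : ι → ℝ} (hw : ∀ i, 0 < w i)
    (g : ι → Y) :
    ∑ j, (w j / ∑ i, w i) / labelShare w g (g j) = (Finset.univ.image g).card := by
  have hW : 0 < ∑ i, w i := Finset.sum_pos (fun i _ => hw i) Finset.univ_nonempty
  rw [← Finset.sum_fiberwise_of_maps_to (s := Finset.univ) (t := Finset.univ.image g) (g := g)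
    fun i _ => Finset.mem_image_of_mem g (Finset.mem_univ i)]
  rw [Finset.cast_card]
  refine Finset.sum_congr rfl fun y hy => ?_
  obtain ⟨j₀, -, rfl⟩ := Finset.mem_image.mp hy
  have hP := labelShare_pos hw g j₀
  have h₁ : ∀ j ∈ Finset.univ.filter (fun j => g j = g j₀),
      (w j / ∑ i, w i) / labelShare w g (g j) =
        w j * (1 / ((∑ i, w i) * labelShare w g (g j₀))) := by
    intro j hj
    rw [(Finset.mem_filter.mp hj).2]
    field_simp
  rw [Finset.sum_congr rfl h₁, ← Finset.sum_mul]
  have h₂ : ∑ j with g j = g j₀, w j = (∑ i, w i) * labelShare w g (g j₀) := by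
    rw [labelShare, Finset.sum_filter]
    field_simp
    exact Finset.sum_congr rfl fun i _ => by congr
  rw [h₂, mul_one_div, div_self (by positivity)]

open Classical in
/-- The loss estimates are unbiased. -/
theorem sum_lossEstimate [Nonempty ι] {w : ι → ℝ} (hw : ∀ i, 0 < w i) (g : ι → Y) (y₀ : Y)
    (e : ι) :
    ∑ j, w j / (∑ i, w i) * lossEstimate w g (g j) (decide (g j ≠ y₀)) e =
      if g e ≠ y₀ then 1 else 0 := by
  have hW : 0 < ∑ i, w i := Finset.sum_pos (fun i _ => hw i) Finset.univ_nonempty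
  have hP := labelShare_pos hw g e
  have h₁ : ∀ j, w j / (∑ i, w i) * lossEstimate w g (g j) (decide (g j ≠ y₀)) e =
      (if g j = g e then w j else 0) *
        ((if g e ≠ y₀ then 1 else 0) / ((∑ i, w i) * labelShare w g (g e))) := by
    intro j
    by_cases hj : g j = g e
    · simp only [lossEstimate, hj, true_and, decide_eq_true_eq, if_true]
      split_ifs
      · field_simp
      · simp
    · simp [lossEstimate, hj, Ne.symm hj]
  rw [Finset.sum_congr rfl fun j _ => h₁ j, ← Finset.sum_mul]
  have h₂ : (∑ i, if g i = g e then w i else 0) = (∑ i, w i) * labelShare w g (g e) := by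
    rw [labelShare]
    field_simp
  rw [h₂]
  field_simp

open Classical in
/-- In one round the expectation of `η` times the loss, plus the logarithm of the total weight, minus
the logarithm of the weight of a fixed expert `e`, grows by at most `η` times the loss of `e` and a
second-order term. -/
theorem sum_potential_le [Nonempty ι] {w : ι → ℝ} (hw : ∀ i, 0 < w i) (g : ι → Y) {k : ℕ}
    (hk : (Finset.univ.image g).card ≤ k) {η : ℝ} (hη : 0 ≤ η) (y₀ : Y) (e : ι) :
    ∑ j, w j / (∑ i, w i) * ((if g j ≠ y₀ then η else 0) +
        Real.log (∑ i, w i * Real.exp (-η * lossEstimate w g (g j) (decide (g j ≠ y₀)) i)) +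
        η * lossEstimate w g (g j) (decide (g j ≠ y₀)) e) ≤
      Real.log (∑ i, w i) + (if g e ≠ y₀ then η else 0) + η ^ 2 * k / 2 := by
  have hW : 0 < ∑ i, w i := Finset.sum_pos (fun i _ => hw i) Finset.univ_nonempty
  have hone : ∑ j, w j / (∑ i, w i) = 1 := by rw [← Finset.sum_div, div_self hW.ne']
  calc _ ≤ ∑ j, (w j / (∑ i, w i) * Real.log (∑ i, w i) +
          η * (w j / (∑ i, w i) * lossEstimate w g (g j) (decide (g j ≠ y₀)) e) +
          η ^ 2 / 2 * ((w j / (∑ i, w i)) / labelShare w g (g j))) := by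
        refine Finset.sum_le_sum fun j _ => ?_
        have h := log_sum_exp_lossEstimate_le hw g hη j (decide (g j ≠ y₀))
        have hq : 0 ≤ w j / ∑ i, w i := (div_pos (hw j) hW).le
        have hP := labelShare_pos hw g j
        simp only [decide_eq_true_eq] at h
        calc _ ≤ w j / (∑ i, w i) * (Real.log (∑ i, w i) + η ^ 2 / (2 * labelShare w g (g j)) +
              η * lossEstimate w g (g j) (decide (g j ≠ y₀)) e) := by
              refine mul_le_mul_of_nonneg_left ?_ hq
              linarith
          _ = _ := by field_simp; ring
    _ = Real.log (∑ i, w i) + (if g e ≠ y₀ then η else 0) +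
          η ^ 2 / 2 * (Finset.univ.image g).card := by
        rw [Finset.sum_add_distrib, Finset.sum_add_distrib, ← Finset.sum_mul, hone,
          ← Finset.mul_sum, ← Finset.mul_sum, sum_lossEstimate hw, sum_div_labelShare hw]
        split_ifs <;> ring
    _ ≤ _ := by
        have : ((Finset.univ.image g).card : ℝ) ≤ k := by exact_mod_cast hk
        nlinarith [sq_nonneg η]

end Weights

/-! ### Exponential weights with bandit feedback over finitely many experts -/

section Experts

variable {ι : Type} [Fintype ι]

/-- The instances of the finished rounds, first one first. -/
def pastInstances (past : List (Round X Y)) : List X := (past.map Round.inst).reverse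

/-- The weights of the experts `f` after the rounds `past`: exponential in the estimated losses. -/
noncomputable def weight (f : ι → List X → X → Y) (η : ℝ) : List (Round X Y) → ι → ℝ
  | [], _ => 1
  | r :: past, i => weight f η past i * Real.exp (-η * lossEstimate (weight f η past)
      (fun i => f i (pastInstances past) r.inst) r.pred r.loss i)

theorem weight_pos (f : ι → List X → X → Y) (η : ℝ) :
    ∀ (past : List (Round X Y)) (i : ι), 0 < weight f η past i
  | [], _ => one_pos
  | _ :: past, i => mul_pos (weight_pos f η past i) (Real.exp_pos _)

/-- The potential whose expectation controls the regret against the expert `e`: `η` times the number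
of mistakes, plus the logarithmic advantage of all experts over `e`. -/
noncomputable def potential (f : ι → List X → X → Y) (η : ℝ) (e : ι) (past : List (Round X Y)) :
    ℝ :=
  η * past.countP Round.loss + Real.log (∑ i, weight f η past i) - Real.log (weight f η past e)

theorem mul_count_le_potential (f : ι → List X → X → Y) (η : ℝ) (e : ι)
    (past : List (Round X Y)) : η * past.countP Round.loss ≤ potential f η e past := by
  have h : Real.log (weight f η past e) ≤ Real.log (∑ i, weight f η past i) :=
    Real.log_le_log (weight_pos f η past e)
      (Finset.single_le_sum (fun i _ => (weight_pos f η past i).le) (Finset.mem_univ e))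
  unfold potential
  linarith

theorem potential_nonneg (f : ι → List X → X → Y) {η : ℝ} (hη : 0 ≤ η) (e : ι)
    (past : List (Round X Y)) : 0 ≤ potential f η e past :=
  (by positivity : 0 ≤ η * (past.countP Round.loss : ℝ)).trans (mul_count_le_potential f η e past)

variable [Nonempty ι]

/-- The law on the experts proportional to positive weights. -/
noncomputable def weightLaw (w : ι → ℝ) (hw : ∀ i, 0 < w i) : PMF ι :=
  PMF.ofFintype (fun i => ENNReal.ofReal (w i / ∑ j, w j)) (by
    have hW : 0 < ∑ i, w i := Finset.sum_pos (fun i _ => hw i) Finset.univ_nonempty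
    rw [← ENNReal.ofReal_sum_of_nonneg fun i _ => (div_pos (hw i) hW).le, ← Finset.sum_div,
      div_self hW.ne', ENNReal.ofReal_one])

theorem expect_weightLaw (w : ι → ℝ) (hw : ∀ i, 0 < w i) {φ : ι → ℝ} (hφ : ∀ i, 0 ≤ φ i) :
    expect (weightLaw w hw) (fun i => ENNReal.ofReal (φ i)) =
      ENNReal.ofReal (∑ i, w i / (∑ j, w j) * φ i) := by
  have hW : 0 < ∑ i, w i := Finset.sum_pos (fun i _ => hw i) Finset.univ_nonempty
  have hq : ∀ i, 0 ≤ w i / ∑ j, w j := fun i => (div_pos (hw i) hW).le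
  rw [expect, tsum_fintype, ENNReal.ofReal_sum_of_nonneg fun i _ => mul_nonneg (hq i) (hφ i)]
  refine Finset.sum_congr rfl fun i _ => ?_
  rw [weightLaw, PMF.ofFintype_apply, ENNReal.ofReal_mul (hq i)]

/-- The learner that follows an expert drawn with probability proportional to its weight. -/
noncomputable def expWeights (f : ι → List X → X → Y) (η : ℝ) : Learner X Y := fun past x =>
  (weightLaw (weight f η past) (weight_pos f η past)).map fun i => f i (pastInstances past) x

open Classical in
theorem expect_potential_step (f : ι → List X → X → Y) {η : ℝ} (hη : 0 ≤ η) (e : ι) {k : ℕ}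
    (hk : ∀ l x, (Finset.univ.image fun i => f i l x).card ≤ k) (past : List (Round X Y))
    (a : X × Y) :
    expect (expWeights f η past a.1)
        (fun y => ENNReal.ofReal (potential f η e (playedRound a y :: past))) ≤
      ENNReal.ofReal (potential f η e past +
        ((if f e (pastInstances past) a.1 ≠ a.2 then η else 0) + η ^ 2 * k / 2)) := by
  set w := weight f η past with hw
  have hpos : ∀ i, 0 < w i := weight_pos f η past
  have hW : 0 < ∑ i, w i := Finset.sum_pos (fun i _ => hpos i) Finset.univ_nonempty
  set g : ι → Y := fun i => f i (pastInstances past) a.1 with hg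
  rw [expWeights, expect_map, expect_weightLaw _ _ fun i => potential_nonneg f hη e _]
  refine ENNReal.ofReal_le_ofReal ?_
  have hone : ∑ j, w j / (∑ i, w i) = 1 := by rw [← Finset.sum_div, div_self hW.ne']
  have hstep : ∀ j, potential f η e (playedRound a (g j) :: past) =
      (η * past.countP Round.loss - Real.log (w e)) + ((if g j ≠ a.2 then η else 0) +
        Real.log (∑ i, w i * Real.exp (-η * lossEstimate w g (g j) (decide (g j ≠ a.2)) i)) +
        η * lossEstimate w g (g j) (decide (g j ≠ a.2)) e) := by
    intro j
    have he : Real.log (weight f η (playedRound a (g j) :: past) e) =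
        Real.log (w e) - η * lossEstimate w g (g j) (decide (g j ≠ a.2)) e := by
      simp only [weight, playedRound]
      rw [Real.log_mul (hpos e).ne' (Real.exp_pos _).ne', Real.log_exp, hg, hw]
      ring
    have hc : ((playedRound a (g j) :: past).countP Round.loss : ℝ) =
        past.countP Round.loss + if g j ≠ a.2 then 1 else 0 := by
      rw [List.countP_cons]
      simp [playedRound]
    rw [potential, he, hc]
    simp only [weight, playedRound, hg, hw]
    split_ifs <;> ring
  have key := sum_potential_le hpos g (hk _ _) hη a.2 e
  calc ∑ j, w j / (∑ i, w i) * potential f η e (playedRound a (g j) :: past)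
      = (η * past.countP Round.loss - Real.log (w e)) +
        ∑ j, w j / (∑ i, w i) * ((if g j ≠ a.2 then η else 0) +
        Real.log (∑ i, w i * Real.exp (-η * lossEstimate w g (g j) (decide (g j ≠ a.2)) i)) +
        η * lossEstimate w g (g j) (decide (g j ≠ a.2)) e) := by
        rw [Finset.sum_congr rfl fun j _ => by rw [hstep j, mul_add], Finset.sum_add_distrib,
          ← Finset.sum_mul, hone, one_mul]
    _ ≤ _ := by
        rw [potential]
        linarith

open Classical in
/-- The regret of exponential weights against a hypothesis that one expert simulates. -/
theorem expectedLoss_expWeights_le (f : ι → List X → X → Y) {η : ℝ} (hη : 0 < η) {k : ℕ}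
    (hk : ∀ l x, (Finset.univ.image fun i => f i l x).card ≤ k)
    (z : ℕ → X × Y) (T : ℕ) (h : X → Y)
    (e : ι) (he : ∀ t < T, f e ((List.range t).map fun s => (z s).1) (z t).1 = h (z t).1) :
    expectedLoss (expWeights f η) z T ≤ hypLoss h z T +
      ENNReal.ofReal (Real.log (Fintype.card ι) / η + η * k * T / 2) := by
  have hcard : (1 : ℝ) ≤ Fintype.card ι := by exact_mod_cast Fintype.card_pos
  have hlog := Real.log_nonneg hcard
  have main : ∀ t ≤ T, expect (transcript (expWeights f η) z t)
      (fun past => ENNReal.ofReal (potential f η e past)) ≤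
        ENNReal.ofReal (Real.log (Fintype.card ι) + (η * hypLoss h z t + η ^ 2 * k / 2 * t)) := by
    intro t
    induction t with
    | zero =>
      intro _
      simp [transcript, expect_pure, potential, weight, hypLoss_zero]
    | succ t ih =>
      intro ht
      rw [expect_transcript_succ]
      calc _ ≤ expect (transcript (expWeights f η) z t) fun past =>
            ENNReal.ofReal (potential f η e past + ((if f e (pastInstances past) (z t).1 ≠ (z t).2
              then η else 0) + η ^ 2 * k / 2)) :=
            expect_mono _ fun past => expect_potential_step f hη.le e hk past (z t)
        _ = expect (transcript (expWeights f η) z t) fun past =>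
            ENNReal.ofReal (potential f η e past) + ENNReal.ofReal ((if h (z t).1 ≠ (z t).2
              then η else 0) + η ^ 2 * k / 2) := by
            refine expect_congr_support _ fun past hp => ?_
            rw [pastInstances, map_inst_of_mem_support _ z t past hp, he t (by omega),
              ENNReal.ofReal_add (potential_nonneg f hη.le e past)
                (by split_ifs <;> positivity)]
        _ ≤ _ := by
            rw [expect_add, expect_const]
            refine (add_le_add_left (ih (by omega)) _).trans_eq ?_
            rw [← ENNReal.ofReal_add (by positivity) (by split_ifs <;> positivity), hypLoss_succ]
            congr 1
            split_ifs <;> push_cast <;> ring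
  have hcount : ENNReal.ofReal η * expectedLoss (expWeights f η) z T ≤
      ENNReal.ofReal (Real.log (Fintype.card ι) + (η * hypLoss h z T + η ^ 2 * k / 2 * T)) := by
    rw [expectedLoss_eq_expect, ← expect_const_mul]
    refine (expect_mono _ fun ω => ?_).trans (main T le_rfl)
    rw [← ENNReal.ofReal_natCast, ← ENNReal.ofReal_mul hη.le]
    exact ENNReal.ofReal_le_ofReal (mul_count_le_potential f η e ω)
  have hη0 : ENNReal.ofReal η ≠ 0 := by simpa using hη
  refine (ENNReal.mul_le_mul_iff_right hη0 ENNReal.ofReal_ne_top).mp (hcount.trans_eq ?_)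
  rw [← ENNReal.ofReal_natCast (hypLoss h z T), ← ENNReal.ofReal_add (by positivity) (by positivity),
    ← ENNReal.ofReal_mul hη.le]
  congr 1
  field_simp
  ring

end Experts

/-! ### The regret bound -/

/-- For every horizon `n` some learner has, at all times up to `n`, the regret
`√(2 n k ln N)` of exponential weights with `N = (1 + n b) ^ L` experts and `k = b + 1` labels. -/
theorem exists_learner_of_horizon {H : Set (X → Y)} (hH : H.Nonempty) {L b n : ℕ} (hL : 0 < L)
    (hb : 0 < b) (hn : 0 < n) (hdim : ¬ LShatterable H (L + 1))
    (hcard : ∀ x, ((fun h : X → Y => h x) '' H).encard ≤ b + 1) :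
    ∃ B : Learner X Y, ∀ h ∈ H, ∀ z : ℕ → X × Y, ∀ j ≤ n, expectedLoss B z j ≤
      hypLoss h z j + ENNReal.ofReal (√(2 * n * (b + 1) * (L * Real.log (1 + n * b)))) := by
  classical
  obtain ⟨h₀, hh₀⟩ := hH
  by_cases hX : IsEmpty X
  · exact ⟨follow h₀, fun _ _ z => (hX.false (z 0).1).elim⟩
  rw [not_isEmpty_iff] at hX
  have : Nonempty Y := hX.map h₀
  obtain ⟨ι, _, _, hN, hf⟩ := exists_expert_cover (X := X) (Y := Y) b n L
  obtain ⟨f, hf⟩ := hf H hdim hcard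
  -- Predictions that no hypothesis makes are replaced, to keep the number of played labels small.
  let g : ι → List X → X → Y := fun i l x =>
    if f i l x ∈ (fun h : X → Y => h x) '' H then f i l x else h₀ x
  have hg : ∀ l x, (Finset.univ.image fun i => g i l x).card ≤ b + 1 := by
    intro l x
    have hsub : ((Finset.univ.image fun i => g i l x : Finset Y) : Set Y) ⊆
        (fun h : X → Y => h x) '' H := by
      intro y hy
      simp only [Finset.coe_image, Finset.coe_univ, Set.image_univ, Set.mem_range] at hy
      obtain ⟨i, rfl⟩ := hy
      by_cases hi : f i l x ∈ (fun h : X → Y => h x) '' H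
      · simpa only [g, if_pos hi] using hi
      · simp only [g, if_neg hi]
        exact ⟨h₀, hh₀, rfl⟩
    have h := (Set.encard_le_encard hsub).trans (hcard x)
    rw [Set.encard_coe_eq_coe_finsetCard] at h
    exact_mod_cast h
  have hn' : (0 : ℝ) < n := by exact_mod_cast hn
  have hb' : (0 : ℝ) < b := by exact_mod_cast hb
  have hL' : (0 : ℝ) < L := by exact_mod_cast hL
  set Λ : ℝ := L * Real.log (1 + n * b) with hΛdef
  have hΛ : 0 < Λ := mul_pos hL' (Real.log_pos (by nlinarith [mul_pos hn' hb']))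
  set S : ℝ := √(2 * n * (b + 1) * Λ) with hSdef
  have hS : 0 < S := Real.sqrt_pos.mpr (by positivity)
  have hS2 : S * S = 2 * n * (b + 1) * Λ := Real.mul_self_sqrt (by positivity)
  -- This rate makes the two terms of the bound equal.
  set η : ℝ := S / (n * (b + 1)) with hηdef
  have hη : 0 < η := by positivity
  refine ⟨expWeights g η, fun h hh z j hj => ?_⟩
  obtain ⟨e, he⟩ := hf h hh ((List.range n).map fun s => (z s).1) (by simp)
  refine (expectedLoss_expWeights_le g hη hg z j h e fun t ht => ?_).trans ?_
  · have h₁ := he t (by simp; omega)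
    have h₂ : f e ((List.range t).map fun s => (z s).1) (z t).1 = h (z t).1 := by
      simpa [← List.map_take, List.take_range, Nat.min_eq_left (show t ≤ n by omega)] using h₁
    have h₃ : f e ((List.range t).map fun s => (z s).1) (z t).1 ∈
        (fun h : X → Y => h (z t).1) '' H := ⟨h, hh, h₂.symm⟩
    simp only [g, if_pos h₃, h₂]
  · gcongr
    have hlogN : Real.log (Fintype.card ι) ≤ Λ := by
      rw [hΛdef, ← Real.log_pow]
      refine Real.log_le_log (by exact_mod_cast Fintype.card_pos) ?_
      exact_mod_cast hN
    have hj' : (j : ℝ) ≤ n := by exact_mod_cast hj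
    push_cast
    calc Real.log (Fintype.card ι) / η + η * (b + 1) * j / 2 ≤ Λ / η + η * (b + 1) * n / 2 := by
          gcongr
      _ = S := by
          rw [hηdef]
          field_simp
          nlinarith

/-- The epochs contribute a geometric sum. -/
theorem sum_sqrt_two_pow_le (m : ℕ) :
    ∑ i ∈ Finset.range (m + 1), √2 ^ i ≤ (2 + √2) * √2 ^ m := by
  have h2 : √2 * √2 = 2 := Real.mul_self_sqrt (by norm_num)
  induction m with
  | zero => simp; linarith [Real.sqrt_nonneg 2]
  | succ m ih =>
    rw [Finset.sum_range_succ]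
    calc _ ≤ (2 + √2) * √2 ^ m + √2 ^ (m + 1) := by gcongr
      _ = (2 + √2) * √2 ^ (m + 1) := by
          rw [pow_succ]
          linear_combination -(√2 ^ m) * h2

/-- In the range where the regret bound is below the trivial bound `T`, the logarithmic factor of
exponential weights is a constant multiple of `ln T`. -/
theorem succ_mul_log_le {L b T : ℕ} (hL : 0 < L) (hb : 0 < b) (hT : 2 ≤ T)
    (hbig : 64 * (L * b * Real.log T) < T) :
    ((b : ℝ) + 1) * Real.log (1 + T * b) ≤ 8 / 3 * (b * Real.log T) := by
  have hL' : (1 : ℝ) ≤ L := by exact_mod_cast hL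
  have hb' : (1 : ℝ) ≤ b := by exact_mod_cast hb
  have hT' : (2 : ℝ) ≤ T := by exact_mod_cast hT
  have hlog : 0.69 < Real.log T :=
    (by linarith [Real.log_two_gt_d9] : (0.69 : ℝ) < Real.log 2).trans_le
      (Real.log_le_log two_pos hT')
  have hbT : 44 * (b : ℝ) ≤ T := by
    have h₁ : (b : ℝ) ≤ L * b := by nlinarith
    have h₂ : (b : ℝ) * 0.69 ≤ L * b * Real.log T := by gcongr
    linarith
  rcases Nat.lt_or_ge b 3 with h3 | h3
  · have hb2 : (b : ℝ) ≤ 2 := by exact_mod_cast Nat.lt_succ_iff.mp h3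
    have h₁ : 3 * Real.log (1 + T * b) ≤ 4 * Real.log T := by
      have h := Real.log_le_log (x := (1 + T * b : ℝ) ^ 3) (y := (T : ℝ) ^ 4) (by positivity) (by
        calc (1 + T * b : ℝ) ^ 3 ≤ (3 * T) ^ 3 := by gcongr; nlinarith
          _ = 27 * (T : ℝ) ^ 3 := by ring
          _ ≤ T * (T : ℝ) ^ 3 := by gcongr; linarith
          _ = _ := by ring)
      rwa [Real.log_pow, Real.log_pow] at h
    have h₂ : 0 ≤ Real.log (1 + T * b) := Real.log_nonneg (by nlinarith)
    nlinarith
  · have hb3 : (3 : ℝ) ≤ b := by exact_mod_cast h3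
    have h₁ : Real.log (1 + T * b) ≤ 2 * Real.log T := by
      have h := Real.log_le_log (x := (1 + T * b : ℝ)) (y := (T : ℝ) ^ 2) (by positivity)
        (by nlinarith)
      rwa [Real.log_pow] at h
    nlinarith

theorem sum_epoch_regret_le {L b T m : ℕ} (hL : 0 < L) (hb : 0 < b) (hT : 2 ≤ T)
    (hm : 2 ^ m ≤ T) (hbig : 64 * (L * b * Real.log T) < T) :
    ∑ i ∈ Finset.range (m + 1),
        √(2 * (2 ^ i : ℕ) * (b + 1) * (L * Real.log (1 + (2 ^ i : ℕ) * b))) ≤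
      8 * √(L * b * T * Real.log T) := by
  have hT' : (2 : ℝ) ≤ T := by exact_mod_cast hT
  have hlogT : 0 ≤ Real.log T := Real.log_nonneg (by linarith)
  have hlog : 0 ≤ Real.log (1 + T * b) := Real.log_nonneg (by
    have : (0 : ℝ) ≤ T * b := by positivity
    linarith)
  have h2 : √2 * √2 = 2 := Real.mul_self_sqrt (by norm_num)
  set C : ℝ := 2 * (b + 1) * (L * Real.log (1 + T * b)) with hC
  have hC0 : 0 ≤ C := by positivity
  have hpow : ∀ i : ℕ, √((2 : ℝ) ^ i) = √2 ^ i := fun i => by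
    rw [Real.sqrt_eq_iff_mul_self_eq (by positivity) (by positivity), ← mul_pow, h2]
  have hterm : ∀ i ∈ Finset.range (m + 1),
      √(2 * (2 ^ i : ℕ) * (b + 1) * (L * Real.log (1 + (2 ^ i : ℕ) * b))) ≤ √C * √2 ^ i := by
    intro i hi
    have hi' : ((2 ^ i : ℕ) : ℝ) ≤ T := by
      have : 2 ^ i ≤ 2 ^ m := Nat.pow_le_pow_right two_pos (by
        have := Finset.mem_range.mp hi
        omega)
      exact_mod_cast this.trans hm
    rw [← hpow, ← Real.sqrt_mul hC0]
    refine Real.sqrt_le_sqrt ?_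
    calc _ ≤ 2 * ((2 ^ i : ℕ) : ℝ) * (b + 1) * (L * Real.log (1 + T * b)) := by gcongr
      _ = C * 2 ^ i := by rw [hC]; push_cast; ring
  have hTm : √2 ^ m ≤ √T := by
    rw [← hpow]
    exact Real.sqrt_le_sqrt (by exact_mod_cast hm)
  calc _ ≤ ∑ i ∈ Finset.range (m + 1), √C * √2 ^ i := Finset.sum_le_sum hterm
    _ = √C * ∑ i ∈ Finset.range (m + 1), √2 ^ i := by rw [Finset.mul_sum]
    _ ≤ √C * ((2 + √2) * √2 ^ m) := by gcongr; exact sum_sqrt_two_pow_le m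
    _ ≤ √C * ((2 + √2) * √T) := by gcongr
    _ = √((2 + √2) ^ 2 * C * T) := by
        rw [mul_assoc, Real.sqrt_mul (sq_nonneg _), Real.sqrt_mul hC0,
          Real.sqrt_sq (by positivity)]
        ring
    _ ≤ √(8 ^ 2 * (L * b * T * Real.log T)) := by
        refine Real.sqrt_le_sqrt ?_
        have hsq : (2 + √2) ^ 2 ≤ 12 := by
          have : √2 ≤ 1.5 := by rw [Real.sqrt_le_left (by norm_num)]; norm_num
          nlinarith
        have hCle : C ≤ 16 / 3 * (L * b * Real.log T) := by
          have := mul_le_mul_of_nonneg_left (succ_mul_log_le hL hb hT hbig)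
            (by positivity : (0 : ℝ) ≤ 2 * L)
          rw [hC]
          linarith
        calc (2 + √2) ^ 2 * C * T ≤ 12 * (16 / 3 * (L * b * Real.log T)) * T := by gcongr
          _ = _ := by ring
    _ = 8 * √(L * b * T * Real.log T) := by
        rw [Real.sqrt_mul (by positivity), Real.sqrt_sq (by norm_num)]

theorem regretBound_of_finite {H : Set (X → Y)} {L b : ℕ} (hL : Ldim H = L) (hb : BLdim H = b)
    (T : ℕ) : regretBound H T = ENNReal.ofReal (8 * √(L * b * T * Real.log T)) := by
  have hlogT : 0 ≤ Real.log T := Real.log_natCast_nonneg T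
  rw [regretBound, hL, hb, Real.sqrt_eq_rpow, ENNReal.ofReal_mul (by norm_num),
    ← ENNReal.ofReal_rpow_of_nonneg (by positivity) (by norm_num),
    ENNReal.ofReal_mul (by positivity), ENNReal.ofReal_mul (by positivity),
    ENNReal.ofReal_mul (by positivity)]
  simp

theorem regretBound_eq_top {H : Set (X → Y)} (hL₀ : Ldim H ≠ 0) (hb₀ : BLdim H ≠ 0)
    (h : Ldim H = ⊤ ∨ BLdim H = ⊤) {T : ℕ} (hT : 2 ≤ T) : regretBound H T = ⊤ := by
  have hlog : ENNReal.ofReal (Real.log T) ≠ 0 := by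
    have : 0 < Real.log T := Real.log_pos (by exact_mod_cast hT)
    simpa using this
  have hT0 : (T : ℝ≥0∞) ≠ 0 := by
    have : T ≠ 0 := by omega
    exact_mod_cast this
  have hL : ((Ldim H : ℕ∞) : ℝ≥0∞) ≠ 0 := by simpa using hL₀
  have hb : ((BLdim H : ℕ∞) : ℝ≥0∞) ≠ 0 := by simpa using hb₀
  have htop : ((Ldim H : ℕ∞) : ℝ≥0∞) * ((BLdim H : ℕ∞) : ℝ≥0∞) = ⊤ := by
    rcases h with h | h
    · rw [h, ENat.toENNReal_top, ENNReal.top_mul hb]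
    · rw [h, ENat.toENNReal_top, ENNReal.mul_top hL]
  rw [regretBound, htop, ENNReal.top_mul hT0, ENNReal.top_mul hlog,
    ENNReal.top_rpow_of_pos (by norm_num), ENNReal.mul_top (by norm_num)]

/-- A bound on the loss against every hypothesis bounds the regret. -/
theorem expectedRegret_le {A : Learner X Y} {H : Set (X → Y)} (hH : H.Nonempty)
    {z : ℕ → X × Y} {T : ℕ} {r : ℝ} (hr : 0 ≤ r)
    (h : ∀ h ∈ H, expectedLoss A z T ≤ hypLoss h z T + ENNReal.ofReal r) :
    expectedRegret A H z T ≤ r := by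
  have : Nonempty H := hH.to_subtype
  rw [expectedRegret, sub_le_comm]
  refine le_ciInf fun g => ?_
  have h₁ := ENNReal.toReal_mono (by simp) (h g.1 g.2)
  rw [ENNReal.toReal_add (by simp) (by simp), ENNReal.toReal_ofReal hr,
    ENNReal.toReal_natCast] at h₁
  linarith

end BanditOnline

open BanditOnline in
theorem theorem2 {X : Type*} {Y : Type*} (H : Set (X → Y)) (hH : H.Nonempty) :
    ∃ A : BanditOnline.Learner X Y, ∀ T : ℕ, 2 ≤ T → ∀ z : ℕ → X × Y,
      ((BanditOnline.expectedRegret A H z T : ℝ) : EReal)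
        ≤ ((BanditOnline.regretBound H T : ℝ≥0∞) : EReal) := by
  obtain ⟨h₀, hh₀⟩ := id hH
  by_cases hzero : Ldim H = 0 ∨ BLdim H = 0
  · -- Either dimension vanishes only if all hypotheses agree, and following one is optimal.
    have hagree : ∀ h ∈ H, h = h₀ := by
      intro h hh
      rcases hzero with h0 | h0
      · exact eq_of_not_lShatterable_one (not_lShatterable_succ (d := 0) (by simpa using h0)) hh hh₀
      · funext x
        have h1 : ((fun h : X → Y => h x) '' H).encard ≤ 1 := by
          simpa using encard_labels_le (b := 0) (by simpa using h0) x
        exact Set.encard_le_one_iff.mp h1 _ _ ⟨h, hh, rfl⟩ ⟨h₀, hh₀, rfl⟩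
    refine ⟨follow h₀, fun T _ z => ?_⟩
    have h : expectedRegret (follow h₀) H z T ≤ 0 :=
      expectedRegret_le hH le_rfl fun h hh => by
        rw [hagree h hh, expectedLoss_follow]
        simp
    exact (EReal.coe_le_coe_iff.mpr h).trans (EReal.coe_ennreal_nonneg _)
  · push Not at hzero
    by_cases htop : Ldim H = ⊤ ∨ BLdim H = ⊤
    · refine ⟨follow h₀, fun T hT z => ?_⟩
      rw [regretBound_eq_top hzero.1 hzero.2 htop hT]
      exact le_top
    push Not at htop
    obtain ⟨L, hL⟩ := ENat.ne_top_iff_exists.mp htop.1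
    obtain ⟨b, hb⟩ := ENat.ne_top_iff_exists.mp htop.2
    have hL0 : 0 < L := Nat.pos_of_ne_zero fun h => hzero.1 (by rw [← hL, h]; rfl)
    have hb0 : 0 < b := Nat.pos_of_ne_zero fun h => hzero.2 (by rw [← hb, h]; rfl)
    have hB := fun m : ℕ => exists_learner_of_horizon (n := 2 ^ m) hH hL0 hb0 (by positivity)
      (not_lShatterable_succ hL.symm) (encard_labels_le hb.symm)
    choose B hB using hB
    refine ⟨doubling B, fun T hT z => ?_⟩
    rw [regretBound_of_finite hL.symm hb.symm, EReal.coe_ennreal_ofReal,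
      EReal.coe_le_coe_iff]
    refine le_trans (expectedRegret_le hH (by positivity) fun h hh => ?_) (le_max_left _ _)
    rcases lt_or_ge (64 * (L * b * Real.log T)) (T : ℝ) with hbig | hsmall
    · -- The last of the `T` rounds lies in the epoch of length `2 ^ Nat.log 2 T ≤ T`.
      have hlow : 2 ^ Nat.log 2 T ≤ T := Nat.pow_log_le_self 2 (by omega)
      have hupp : T < 2 ^ (Nat.log 2 T + 1) := Nat.lt_pow_succ_log_self one_lt_two T
      have hT' : T = 2 ^ Nat.log 2 T - 1 + (T + 1 - 2 ^ Nat.log 2 T) := by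
        have : 0 < 2 ^ Nat.log 2 T := by positivity
        omega
      have key := expectedLoss_doubling_le B
        (fun i => ENNReal.ofReal
          (√(2 * (2 ^ i : ℕ) * (b + 1) * (L * Real.log (1 + (2 ^ i : ℕ) * b))))) h
        (fun m => hB m h hh) z (Nat.log 2 T) (T + 1 - 2 ^ Nat.log 2 T)
        (by rw [pow_succ] at hupp; omega)
      rw [← hT'] at key
      refine key.trans (add_le_add_right ?_ _)
      rw [← ENNReal.ofReal_sum_of_nonneg fun i _ => Real.sqrt_nonneg _]
      exact ENNReal.ofReal_le_ofReal (sum_epoch_regret_le hL0 hb0 hT hlow hbig)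
    · -- Here the bound is at least `T`.
      refine (expectedLoss_le _ z T).trans (le_add_left ?_)
      rw [← ENNReal.ofReal_natCast]
      refine ENNReal.ofReal_le_ofReal ?_
      have h8 : (8 : ℝ) = √(8 ^ 2) := (Real.sqrt_sq (by norm_num)).symm
      rw [h8, ← Real.sqrt_mul (by norm_num)]
      refine Real.le_sqrt_of_sq_le ?_
      have := mul_le_mul_of_nonneg_left hsmall (Nat.cast_nonneg (α := ℝ) T)
      linarith
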